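/- For integers $k,g\ge 3$, a $(k,g)$-graph is a finite simple $k$-regular graph of girth exactly $g$; its order is its number of vertices. The $(k,g)$-spectrum is the set of orders of connected $(k,g)$-graphs. Call an order $n$ admissible for $k$ if $k$ is even or $n$ is even, and let $N(k,g)$ be the smallest admissible $N$ such that a $(k,g)$-graph of order $n$ exists for every admissible $n\ge N$. Then: - the $(5,3)$-spectrum is $\{n : n \text{ even},\ n\ge 6\}$, and $N(5,3)=6$; - the $(5,4)$-spectrum is $\{n : n \text{ even},\ n\ge 10\}$, and $N(5,4)=10$; - the $(5,6)$-spectrum is $\{42\}\cup\{n : n \text{ even},\ n\ge 46\}$, there is no $(5,6)$-graph of order $44$ (connected or not), and $N(5,6)=46$; - the $(6,3)$-spectrum is $\{n : n\ge 7\}$, and $N(6,3)=7$; - the $(6,4)$-spectrum is $\{12\}\cup\{n : n\ge 14\}$, there is no $(6,4)$-graph of order $13$ (connected or not), and $N(6,4)=14$; - the $(7,3)$-spectrum is $\{n : n \text{ even},\ n\ge 8\}$, and $N(7,3)=8$; - the $(7,4)$-spectrum is $\{n : n \text{ even},\ n\ge 14\}$, and $N(7,4)=14$. -/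

import Mathlib

/-- `G` is a `(k,g)`-graph: it is `k`-regular and its shortest cycle has length exactly `g`. -/
def IsKGGraph {V : Type*} (G : SimpleGraph V) [G.LocallyFinite] (k g : ℕ) : Prop :=
  G.IsRegularOfDegree k ∧ G.egirth = (g : ℕ∞)

open Classical in
/-- The orders of all `(k,g)`-graphs, connected or not. -/
def kgOrders (k g : ℕ) : Set ℕ :=
  {n | ∃ G : SimpleGraph (Fin n), IsKGGraph G k g}

open Classical in
/-- The `(k,g)`-spectrum: the orders of the connected `(k,g)`-graphs. -/
def kgSpectrum (k g : ℕ) : Set ℕ :=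
  {n | ∃ G : SimpleGraph (Fin n), G.Connected ∧ IsKGGraph G k g}

/-- The orders that degree `k` allows: all orders if `k` is even, the even ones if `k` is odd. -/
def AdmissibleOrder (k n : ℕ) : Prop := Odd k → Even n

/-- `N = N(k,g)`: the smallest admissible order from which on `(k,g)`-graphs of every admissible
order exist. -/
def IsKGThreshold (k g N : ℕ) : Prop :=
  IsLeast {M : ℕ | AdmissibleOrder k M ∧
    ∀ n : ℕ, M ≤ n → AdmissibleOrder k n → n ∈ kgOrders k g} N

/-! Existence comes from explicit Cayley-type graphs, always connected; nonexistence is proved for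
all `(k,g)`-graphs, so it also settles the thresholds.

Girth 3 and `(6,4)` use circulants. The `(5,4)`, `(7,4)` and `(5,6)` rows use Haar graphs, which are
bipartite; such a graph has girth at least 6 when its connection set is a Sidon set.

The lower bounds are `k < n`, `2k ≤ n` for girth at least 4, and the Moore bound `42` for `(5,6)`;
for odd `k` the handshake lemma forces even order. Only orders 13 and 44 remain.

Order 13 (`card_ne_13`): deleting a vertex and its 6 neighbours leaves 6 vertices spanning 3 edges,
but one such edge forces too many others.

Order 44 (`card_ne_44`): the 18 vertices at distance more than two from `u` induce a star with five
edges plus isolated vertices. Hence the graph is bipartite with sides of size 22. Its biadjacency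
matrix `N` satisfies `N Nᵀ = 4I + J - P` with `P` a fixed-point-free involution, whose determinant
is 5 times a square, so `det N` cannot be rational. -/

namespace SimpleGraph
variable {V : Type*} {G : SimpleGraph V}

/-! ### Short cycles and girth bounds -/

theorem egirth_le_three {a b c : V} (hab : G.Adj a b) (hbc : G.Adj b c) (hca : G.Adj c a) :
    G.egirth ≤ 3 := by
  have h : (Walk.cons hab (.cons hbc (.cons hca .nil))).IsCycle := by
    have := hab.ne; have := hbc.ne; have := hca.ne
    simp [Walk.isCycle_def, Walk.isTrail_def, *, Ne.symm]
  simpa using egirth_le_length h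

theorem egirth_le_four {a b c d : V} (hab : G.Adj a b) (hbc : G.Adj b c) (hcd : G.Adj c d)
    (hda : G.Adj d a) (hac : a ≠ c) (hbd : b ≠ d) : G.egirth ≤ 4 := by
  have h : (Walk.cons hab (.cons hbc (.cons hcd (.cons hda .nil)))).IsCycle := by
    have := hab.ne; have := hbc.ne; have := hcd.ne; have := hda.ne
    simp [Walk.isCycle_def, Walk.isTrail_def]
    grind
  simpa using egirth_le_length h

theorem egirth_le_five {a b c d e : V} (hab : G.Adj a b) (hbc : G.Adj b c) (hcd : G.Adj c d)
    (hde : G.Adj d e) (hea : G.Adj e a) (h : [a, b, c, d, e].Nodup) : G.egirth ≤ 5 := by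
  have h : (Walk.cons hab (.cons hbc (.cons hcd (.cons hde (.cons hea .nil))))).IsCycle := by
    simp [Walk.isCycle_def, Walk.isTrail_def] at h ⊢
    grind
  simpa using egirth_le_length h

theorem egirth_le_six {a b c d e f : V} (hab : G.Adj a b) (hbc : G.Adj b c) (hcd : G.Adj c d)
    (hde : G.Adj d e) (hef : G.Adj e f) (hfa : G.Adj f a) (h : [a, b, c, d, e, f].Nodup) :
    G.egirth ≤ 6 := by
  have h : (Walk.cons hab (.cons hbc (.cons hcd (.cons hde (.cons hef (.cons hfa .nil)))))).IsCycle
      := by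
    simp [Walk.isCycle_def, Walk.isTrail_def] at h ⊢
    grind
  simpa using egirth_le_length h

theorem Walk.exists_triangle {a : V} (w : G.Walk a a) (h : w.length = 3) :
    ∃ b c, G.Adj a b ∧ G.Adj b c ∧ G.Adj c a := by
  match w, h with
  | .cons h1 (.cons h2 (.cons h3 .nil)), _ => exact ⟨_, _, h1, h2, h3⟩

theorem Walk.IsCycle.exists_of_length_eq_four {a : V} {w : G.Walk a a} (hw : w.IsCycle)
    (h : w.length = 4) :
    ∃ b c d, G.Adj a b ∧ G.Adj b c ∧ G.Adj c d ∧ G.Adj d a ∧ a ≠ c ∧ b ≠ d := by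
  match w, h with
  | .cons h1 (.cons h2 (.cons h3 (.cons h4 .nil))), _ =>
    refine ⟨_, _, _, h1, h2, h3, h4, ?_, ?_⟩
    all_goals
      have := hw.support_nodup
      simp at this
      grind

theorem four_le_egirth (h : ∀ a b c, G.Adj a b → G.Adj b c → G.Adj c a → False) :
    4 ≤ G.egirth := by
  rw [le_egirth]
  intro a w hw
  by_contra! hlt
  have h3 := hw.three_le_length
  have hlt : w.length < 4 := by exact_mod_cast hlt
  obtain ⟨b, c, h1, h2, h3⟩ := w.exists_triangle (by omega)
  exact h _ _ _ h1 h2 h3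

theorem Coloring.even_length {a : V} (c : G.Coloring Bool) (w : G.Walk a a) : Even w.length := by
  rw [c.even_length_iff_congr w]

theorem Coloring.four_le_egirth (c : G.Coloring Bool) : 4 ≤ G.egirth := by
  rw [le_egirth]
  intro a w hw
  have h3 := hw.three_le_length
  obtain ⟨m, hm⟩ := c.even_length w
  exact_mod_cast (by omega : 4 ≤ w.length)

/-- Closed walks in a bipartite graph have even length, so only 4-cycles need excluding. -/
theorem Coloring.six_le_egirth (c : G.Coloring Bool)
    (h : ∀ x y z w, G.Adj x y → G.Adj y z → G.Adj z w → G.Adj w x → x ≠ z → y ≠ w → False) :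
    6 ≤ G.egirth := by
  rw [le_egirth]
  intro a w hw
  have h3 := hw.three_le_length
  obtain ⟨m, hm⟩ := c.even_length w
  have h4 : w.length ≠ 4 := by
    intro h4
    obtain ⟨x, y, z, hx⟩ := hw.exists_of_length_eq_four h4
    exact h _ _ _ _ hx.1 hx.2.1 hx.2.2.1 hx.2.2.2.1 hx.2.2.2.2.1 hx.2.2.2.2.2
  exact_mod_cast (by omega : 6 ≤ w.length)

end SimpleGraph

open Classical in
theorem mem_kgSpectrum_of_connected {V : Type*} [Fintype V] {G : SimpleGraph V} {n k g : ℕ}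
    (hn : Fintype.card V = n) (hconn : G.Connected) (hreg : ∀ v, (G.neighborSet v).ncard = k)
    (hg : G.egirth = g) : n ∈ kgSpectrum k g := by
  let e := G.overFinIso hn
  refine ⟨G.overFin hn, e.connected_iff.1 hconn, fun v => ?_, by rw [← hg, e.symm.egirth_eq]⟩
  obtain ⟨v, rfl⟩ := e.surjective v
  rw [e.degree_eq, ← hreg v, ← SimpleGraph.card_neighborFinset_eq_degree, ← Set.ncard_coe_finset,
    SimpleGraph.coe_neighborFinset]

theorem kgSpectrum_subset_kgOrders (k g : ℕ) : kgSpectrum k g ⊆ kgOrders k g :=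
  fun _ ⟨G, _, h⟩ => ⟨G, h⟩

/-! ### Circulant graphs -/

theorem ZMod.card_image_intCast {n : ℕ} {T : Finset ℤ} {a : ℤ}
    (h : ∀ t ∈ T, a ≤ t ∧ t < a + n) : (T.image (Int.cast : ℤ → ZMod n)).card = T.card := by
  refine Finset.card_image_of_injOn fun s hs t ht hst => ?_
  have hs := h s hs
  have ht := h t ht
  have hd : (n : ℤ) ∣ t - s := (ZMod.intCast_eq_intCast_iff_dvd_sub _ _ _).1 hst
  have := Int.eq_zero_of_abs_lt_dvd hd (by rw [abs_lt]; constructor <;> linarith)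
  linarith

theorem ZMod.natCast_ne_zero_of_lt {n k : ℕ} (h0 : 0 < k) (h : k < n) : (k : ZMod n) ≠ 0 := by
  rw [Ne, ZMod.natCast_eq_zero_iff]
  exact Nat.not_dvd_of_pos_of_lt h0 h

/-- The circulant graph on `ZMod n` with symmetric connection set `S`. -/
def circulant {n : ℕ} (S : Finset (ZMod n)) (h0 : 0 ∉ S) (hS : ∀ s ∈ S, -s ∈ S) :
    SimpleGraph (ZMod n) where
  Adj x y := y - x ∈ S
  symm := ⟨fun x y h => by simpa using hS _ h⟩
  loopless := ⟨fun x h => h0 (by simpa using h)⟩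

section circulant
variable {n : ℕ} {S : Finset (ZMod n)} {h0 : 0 ∉ S} {hS : ∀ s ∈ S, -s ∈ S}

theorem circulant_adj {x y : ZMod n} : (circulant S h0 hS).Adj x y ↔ y - x ∈ S := Iff.rfl

theorem circulant_ncard_neighborSet (x : ZMod n) :
    ((circulant S h0 hS).neighborSet x).ncard = S.card := by
  have : (circulant S h0 hS).neighborSet x = (x + ·) '' (S : Set (ZMod n)) := by
    ext y
    simp [circulant_adj, sub_eq_neg_add]
  rw [this, Set.ncard_image_of_injective _ (add_right_injective x), Set.ncard_coe_finset]

theorem circulant_connected [NeZero n] (h1 : 1 ∈ S) : (circulant S h0 hS).Connected := by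
  have key : ∀ k : ℕ, (circulant S h0 hS).Reachable 0 (k : ZMod n) := by
    intro k
    induction k with
    | zero => simp
    | succ k ih =>
      refine ih.trans (SimpleGraph.Adj.reachable ?_)
      simpa [circulant_adj] using h1
  have key' : ∀ x, (circulant S h0 hS).Reachable 0 x := fun x => by
    simpa using key x.val
  exact ⟨fun x y => (key' x).symm.trans (key' y)⟩

end circulant

theorem Int.not_dvd_of_ne_zero_of_lt {n t : ℤ} (h0 : t ≠ 0) (h1 : -n < t) (h2 : t < n) :
    ¬ n ∣ t :=
  fun h => h0 (Int.eq_zero_of_abs_lt_dvd h (abs_lt.2 ⟨h1, h2⟩))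

/-- Inverses are required only modulo `n`, so that `n/2` may serve as its own negative. -/
theorem circulant_image_aux {n : ℕ} {T : Finset ℤ} (h0 : ∀ t ∈ T, t ≠ 0 ∧ -(n : ℤ) < t ∧ t < n)
    (hT : ∀ t ∈ T, ∃ s ∈ T, (n : ℤ) ∣ t + s) :
    (0 : ZMod n) ∉ T.image (Int.cast : ℤ → ZMod n) ∧
    ∀ s ∈ T.image (Int.cast : ℤ → ZMod n), -s ∈ T.image (Int.cast : ℤ → ZMod n) := by
  simp only [Finset.mem_image, not_exists, not_and, forall_exists_index, and_imp,
    forall_apply_eq_imp_iff₂]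
  refine ⟨fun t ht h => Int.not_dvd_of_ne_zero_of_lt (h0 t ht).1 (h0 t ht).2.1
    (h0 t ht).2.2 ((ZMod.intCast_zmod_eq_zero_iff_dvd _ _).1 h), fun t ht => ?_⟩
  obtain ⟨s, hs, h⟩ := hT t ht
  refine ⟨s, hs, ?_⟩
  have := (ZMod.intCast_zmod_eq_zero_iff_dvd _ n).2 h
  push_cast at this
  linear_combination this

theorem mem_kgSpectrum_three {n : ℕ} {k : ℕ} {T : Finset ℤ} (hk : T.card = k) {a : ℤ} (hn : 0 < n)
    (hwin : ∀ t ∈ T, a ≤ t ∧ t < a + n) (h0 : ∀ t ∈ T, t ≠ 0 ∧ -(n : ℤ) < t ∧ t < n)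
    (hT : ∀ t ∈ T, ∃ s ∈ T, (n : ℤ) ∣ t + s) (h1 : 1 ∈ T) (h2 : 2 ∈ T) :
    n ∈ kgSpectrum k 3 := by
  have : NeZero n := ⟨hn.ne'⟩
  obtain ⟨h0', hT'⟩ := circulant_image_aux h0 hT
  have m1 : (1 : ZMod n) ∈ T.image (Int.cast : ℤ → ZMod n) :=
    Finset.mem_image.2 ⟨1, h1, by simp⟩
  have m2 : (2 : ZMod n) ∈ T.image (Int.cast : ℤ → ZMod n) :=
    Finset.mem_image.2 ⟨2, h2, by simp⟩
  refine mem_kgSpectrum_of_connected (G := circulant _ h0' hT') (ZMod.card n)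
    (circulant_connected m1) (fun v => ?_) ?_
  · rw [circulant_ncard_neighborSet, ZMod.card_image_intCast hwin, hk]
  · refine le_antisymm ?_ SimpleGraph.three_le_egirth
    refine SimpleGraph.egirth_le_three (a := 0) (b := 1) (c := 2) ?_ ?_
      (SimpleGraph.Adj.symm ?_) <;> rw [circulant_adj]
    · simpa using m1
    · convert m1 using 1; ring
    · simpa using m2

/-- A triangle is a zero-sum triple of connection elements, which `hsum` forbids; commutativity
gives the 4-cycle `0, 1, u + 1, u`. -/
theorem mem_kgSpectrum_four {n : ℕ} {k : ℕ} {T : Finset ℤ} (hk : T.card = k) {a u : ℤ} (hn : 2 < n)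
    (hwin : ∀ t ∈ T, a ≤ t ∧ t < a + n) (h0 : ∀ t ∈ T, t ≠ 0 ∧ -(n : ℤ) < t ∧ t < n)
    (hT : ∀ t ∈ T, ∃ s ∈ T, (n : ℤ) ∣ t + s) (h1 : 1 ∈ T) (hu : u ∈ T)
    (hu1 : 1 < u) (hu2 : u + 1 < n)
    (hsum : ∀ r ∈ T, ∀ s ∈ T, ∀ t ∈ T, ¬ (n : ℤ) ∣ r + s + t) :
    n ∈ kgSpectrum k 4 := by
  have : NeZero n := ⟨by omega⟩
  obtain ⟨h0', hT'⟩ := circulant_image_aux h0 hT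
  have m1 : (1 : ZMod n) ∈ T.image (Int.cast : ℤ → ZMod n) :=
    Finset.mem_image.2 ⟨1, h1, by simp⟩
  have mu : (u : ZMod n) ∈ T.image (Int.cast : ℤ → ZMod n) :=
    Finset.mem_image.2 ⟨u, hu, by simp⟩
  refine mem_kgSpectrum_of_connected (G := circulant _ h0' hT') (ZMod.card n)
    (circulant_connected m1) (fun v => ?_) ?_
  · rw [circulant_ncard_neighborSet, ZMod.card_image_intCast hwin, hk]
  · refine le_antisymm ?_ (SimpleGraph.four_le_egirth fun x y z hx hy hz => ?_)
    · refine SimpleGraph.egirth_le_four (a := 0) (b := 1) (c := u + 1) (d := u) ?_ ?_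
        (SimpleGraph.Adj.symm ?_) (SimpleGraph.Adj.symm ?_) ?_ ?_
      · simpa [circulant_adj] using m1
      · simpa [circulant_adj] using mu
      · simpa [circulant_adj] using m1
      · simpa [circulant_adj] using mu
      · intro h
        apply Int.not_dvd_of_ne_zero_of_lt (n := n) (t := u + 1) (by omega) (by omega) (by omega)
        rw [← ZMod.intCast_zmod_eq_zero_iff_dvd]
        push_cast
        exact h.symm
      · intro h
        apply Int.not_dvd_of_ne_zero_of_lt (n := n) (t := u - 1) (by omega) (by omega) (by omega)
        rw [← ZMod.intCast_zmod_eq_zero_iff_dvd]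
        push_cast
        rw [← h, sub_self]
    · rw [circulant_adj, Finset.mem_image] at hx hy hz
      obtain ⟨r, hr, hr'⟩ := hx
      obtain ⟨s, hs, hs'⟩ := hy
      obtain ⟨t, ht, ht'⟩ := hz
      apply hsum r hr s hs t ht
      rw [← ZMod.intCast_zmod_eq_zero_iff_dvd]
      push_cast
      rw [hr', hs', ht']
      ring

/-! ### Haar graphs -/

/-- The Haar graph: the bipartite graph on two copies of `A` in which the point `x` is joined to
the block `y` when `y - x ∈ S`. -/
def haarGraph {A : Type*} [AddCommGroup A] (S : Finset A) : SimpleGraph (A ⊕ A) where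
  Adj
    | .inl x, .inr y => y - x ∈ S
    | .inr y, .inl x => y - x ∈ S
    | _, _ => False
  symm := ⟨by rintro (x | x) (y | y) h <;> exact h⟩
  loopless := ⟨by rintro (x | x) h <;> exact h⟩

section haar
variable {A : Type*} [AddCommGroup A] {S : Finset A} {x y : A}

@[simp] theorem haarGraph_inl_inr : (haarGraph S).Adj (.inl x) (.inr y) ↔ y - x ∈ S := Iff.rfl
@[simp] theorem haarGraph_inr_inl : (haarGraph S).Adj (.inr y) (.inl x) ↔ y - x ∈ S := Iff.rfl
@[simp] theorem haarGraph_inl_inl : ¬ (haarGraph S).Adj (.inl x) (.inl y) := fun h => h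
@[simp] theorem haarGraph_inr_inr : ¬ (haarGraph S).Adj (.inr x) (.inr y) := fun h => h

/-- The bipartition of a Haar graph. -/
def haarGraphColoring (S : Finset A) : (haarGraph S).Coloring Bool :=
  SimpleGraph.Coloring.mk Sum.isLeft (by rintro (x | x) (y | y) <;> simp)

theorem haarGraph_ncard_neighborSet (v : A ⊕ A) :
    ((haarGraph S).neighborSet v).ncard = S.card := by
  rcases v with x | y
  · have : (haarGraph S).neighborSet (.inl x) = (fun s => Sum.inr (x + s)) '' (S : Set A) := by
      ext (y | y) <;> simp
      constructor
      · intro h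
        exact ⟨_, h, by abel⟩
      · rintro ⟨s, hs, rfl⟩
        simpa using hs
    rw [this, Set.ncard_image_of_injective _ (fun s t h => by simpa using h), Set.ncard_coe_finset]
  · have : (haarGraph S).neighborSet (.inr y) = (fun s => Sum.inl (y - s)) '' (S : Set A) := by
      ext (x | x) <;> simp
      constructor
      · intro h
        exact ⟨_, h, by abel⟩
      · rintro ⟨s, hs, rfl⟩
        simpa using hs
    rw [this, Set.ncard_image_of_injective _ (fun s t h => by simpa using h), Set.ncard_coe_finset]

/-- The signed sum of differences around a 4-cycle vanishes, giving `a + c = b + d`; the Sidon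
condition makes the cycle degenerate. -/
theorem haarGraph_six_le_egirth
    (hS : ∀ a ∈ S, ∀ b ∈ S, ∀ c ∈ S, ∀ d ∈ S, a + c = b + d → a = b ∨ a = d) :
    6 ≤ (haarGraph S).egirth := by
  have key : ∀ x y z w : A, y - x ∈ S → y - z ∈ S → w - z ∈ S → w - x ∈ S → x ≠ z → y ≠ w →
      False := by
    intro x y z w h1 h2 h3 h4 hxz hyw
    rcases hS _ h1 _ h2 _ h3 _ h4 (by abel) with h | h
    · exact hxz (by simpa using h)
    · exact hyw (by simpa using h)
  refine (haarGraphColoring S).six_le_egirth ?_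
  rintro (x | x) (y | y) (z | z) (w | w) <;> simp
  · intro h1 h2 h3 h4 h5
    by_contra h6
    exact key _ _ _ _ h1 h2 h3 h4 h5 h6
  · intro h1 h2 h3 h4 h5
    by_contra h6
    exact key _ _ _ _ h2 h3 h4 h1 h6 (Ne.symm h5)

end haar

theorem haarGraph_connected {m : ℕ} [NeZero m] {S : Finset (ZMod m)} (h0 : 0 ∈ S) (h1 : 1 ∈ S) :
    (haarGraph S).Connected := by
  have step : ∀ x : ZMod m, (haarGraph S).Reachable (.inl x) (.inr x) := fun x =>
    SimpleGraph.Adj.reachable (by simpa using h0)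
  have key : ∀ k : ℕ, (haarGraph S).Reachable (.inl 0) (.inl (k : ZMod m)) := by
    intro k
    induction k with
    | zero => simp
    | succ k ih =>
      refine ih.trans (SimpleGraph.Reachable.trans (SimpleGraph.Adj.reachable ?_) (step _).symm)
      simpa using h1
  have key' : ∀ v, (haarGraph S).Reachable (.inl 0) v := by
    rintro (x | x)
    · simpa using key x.val
    · refine SimpleGraph.Reachable.trans ?_ (step x)
      simpa using key x.val
  exact ⟨fun x y => (key' x).symm.trans (key' y)⟩

theorem mem_kgSpectrum_of_haarGraph {m k g : ℕ} {T : Finset ℤ} (hk : T.card = k) (h0 : 0 ∈ T) (h1 : 1 ∈ T)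
    (hwin : ∀ t ∈ T, 0 ≤ t ∧ t < m)
    (hg : (haarGraph (T.image (Int.cast : ℤ → ZMod m))).egirth = g) :
    m + m ∈ kgSpectrum k g := by
  have : NeZero m := ⟨by have := hwin _ h0; omega⟩
  refine mem_kgSpectrum_of_connected (by simp [ZMod.card]) (haarGraph_connected
    (Finset.mem_image.2 ⟨0, h0, by simp⟩) (Finset.mem_image.2 ⟨1, h1, by simp⟩)) (fun v => ?_) hg
  rw [haarGraph_ncard_neighborSet, ZMod.card_image_intCast (a := 0) (by simpa using hwin), hk]

theorem mem_kgSpectrum_four_of_haarGraph {m k : ℕ} {T : Finset ℤ} (hk : T.card = k) (h0 : 0 ∈ T) (h1 : 1 ∈ T)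
    (h2 : 2 ∈ T) (hwin : ∀ t ∈ T, 0 ≤ t ∧ t < m) : m + m ∈ kgSpectrum k 4 := by
  refine mem_kgSpectrum_of_haarGraph hk h0 h1 hwin
    (le_antisymm ?_ (haarGraphColoring _).four_le_egirth)
  have : Fact (1 < m) := ⟨by have := hwin _ h1; omega⟩
  refine SimpleGraph.egirth_le_four (a := .inl 0) (b := .inr 1) (c := .inl 1) (d := .inr 2)
    ?_ ?_ ?_ ?_ (by simp) ?_
  · simpa using ⟨1, h1, by simp⟩
  · simpa using ⟨0, h0, by simp⟩
  · simpa using ⟨1, h1, by ring_nf⟩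
  · simpa using ⟨2, h2, by simp⟩
  · intro h
    have h : (1 : ZMod m) = 2 := by simpa using h
    have : (1 : ZMod m) = 0 := by linear_combination -h
    exact one_ne_zero this

theorem mem_kgSpectrum_six_of_haarGraph {m k : ℕ} {T : Finset ℤ} (hk : T.card = k) (hm : 4 < m) (h0 : 0 ∈ T)
    (h1 : 1 ∈ T) (h4 : 4 ∈ T) (hwin : ∀ t ∈ T, 0 ≤ t ∧ t < m)
    (hT : ∀ a ∈ T, ∀ b ∈ T, ∀ c ∈ T, ∀ d ∈ T, (m : ℤ) ∣ a + c - (b + d) → a = b ∨ a = d) :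
    m + m ∈ kgSpectrum k 6 := by
  refine mem_kgSpectrum_of_haarGraph hk h0 h1 hwin (le_antisymm ?_ (haarGraph_six_le_egirth ?_))
  · have n1 : (1 : ZMod m) ≠ 0 := by simpa using ZMod.natCast_ne_zero_of_lt one_pos (by omega)
    have n3 : (3 : ZMod m) ≠ 0 := by
      exact_mod_cast ZMod.natCast_ne_zero_of_lt (n := m) (k := 3) (by omega) (by omega)
    have n4 : (4 : ZMod m) ≠ 0 := by
      exact_mod_cast ZMod.natCast_ne_zero_of_lt (n := m) (k := 4) (by omega) (by omega)
    -- The differences along this hexagon are 0, 1, 4, 0, 1, 4; their alternating sum vanishes.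
    refine SimpleGraph.egirth_le_six (a := .inl 0) (b := .inr 0) (c := .inl (-1)) (d := .inr 3)
      (e := .inl 3) (f := .inr 4) ?_ ?_ ?_ ?_ ?_ ?_ ?_
    · simpa using ⟨0, h0, by simp⟩
    · simpa using ⟨1, h1, by simp⟩
    · simpa using ⟨4, h4, by ring_nf⟩
    · simpa using ⟨0, h0, by simp⟩
    · simpa using ⟨1, h1, by ring_nf⟩
    · simpa using ⟨4, h4, by simp⟩
    · have e1 : (-1 : ZMod m) ≠ 3 := fun h => n4 (by linear_combination -h)
      have e2 : (3 : ZMod m) ≠ 4 := fun h => n1 (by linear_combination -h)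
      simp [n1, n3.symm, n4.symm, e1, e2]
  · simp only [Finset.mem_image]
    rintro _ ⟨a, ha, rfl⟩ _ ⟨b, hb, rfl⟩ _ ⟨c, hc, rfl⟩ _ ⟨d, hd, rfl⟩ h
    have : (m : ℤ) ∣ a + c - (b + d) := by
      rw [← ZMod.intCast_zmod_eq_zero_iff_dvd]
      push_cast
      rw [h, sub_self]
    rcases hT a ha b hb c hc d hd this with rfl | rfl <;> simp

/-! ### Explicit families -/

theorem mem_kgSpectrum_five_three {n : ℕ} (hn : Even n) (h : 6 ≤ n) : n ∈ kgSpectrum 5 3 := by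
  obtain ⟨m, rfl⟩ := hn
  have hcard : ({-2, -1, 1, 2, (m : ℤ)} : Finset ℤ).card = 5 := by
    have h1 : (-1 : ℤ) ≠ m := by omega
    have h2 : (-2 : ℤ) ≠ m := by omega
    have h3 : (1 : ℤ) ≠ m := by omega
    have h4 : (2 : ℤ) ≠ m := by omega
    simp [h1, h2, h3, h4]
  refine mem_kgSpectrum_three hcard (a := -2) (by omega) ?_ ?_ ?_ (by simp) (by simp)
  · simp; omega
  · simp; omega
  · simp only [Finset.mem_insert, Finset.mem_singleton]
    rintro t (rfl | rfl | rfl | rfl | rfl)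
    exacts [⟨2, by simp⟩, ⟨1, by simp⟩, ⟨-1, by simp⟩, ⟨-2, by simp⟩, ⟨m, by simp⟩]

theorem mem_kgSpectrum_seven_three {n : ℕ} (hn : Even n) (h : 8 ≤ n) : n ∈ kgSpectrum 7 3 := by
  obtain ⟨m, rfl⟩ := hn
  have hcard : ({-3, -2, -1, 1, 2, 3, (m : ℤ)} : Finset ℤ).card = 7 := by
    have h1 : (-1 : ℤ) ≠ m := by omega
    have h2 : (-2 : ℤ) ≠ m := by omega
    have h3 : (1 : ℤ) ≠ m := by omega
    have h4 : (2 : ℤ) ≠ m := by omega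
    have h5 : (-3 : ℤ) ≠ m := by omega
    have h6 : (3 : ℤ) ≠ m := by omega
    simp [h1, h2, h3, h4, h5, h6]
  refine mem_kgSpectrum_three hcard (a := -3) (by omega) ?_ ?_ ?_ (by simp) (by simp)
  · simp; omega
  · simp; omega
  · simp only [Finset.mem_insert, Finset.mem_singleton]
    rintro t (rfl | rfl | rfl | rfl | rfl | rfl | rfl)
    exacts [⟨3, by simp⟩, ⟨2, by simp⟩, ⟨1, by simp⟩, ⟨-1, by simp⟩, ⟨-2, by simp⟩, ⟨-3, by simp⟩,
      ⟨m, by simp⟩]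

theorem mem_kgSpectrum_six_three {n : ℕ} (h : 7 ≤ n) : n ∈ kgSpectrum 6 3 := by
  refine mem_kgSpectrum_three (T := {-3, -2, -1, 1, 2, 3}) (by decide) (a := -3) (by omega) ?_ ?_ ?_
    (by simp) (by simp)
  · simp; omega
  · simp; omega
  · intro t ht
    exact ⟨-t, by revert t; decide, by simp⟩

theorem mem_kgSpectrum_five_four {n : ℕ} (hn : Even n) (h : 10 ≤ n) : n ∈ kgSpectrum 5 4 := by
  obtain ⟨m, rfl⟩ := hn
  refine mem_kgSpectrum_four_of_haarGraph (T := {0, 1, 2, 3, 4}) (by decide) (by simp) (by simp) (by simp) ?_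
  simp; omega

theorem mem_kgSpectrum_seven_four {n : ℕ} (hn : Even n) (h : 14 ≤ n) : n ∈ kgSpectrum 7 4 := by
  obtain ⟨m, rfl⟩ := hn
  refine mem_kgSpectrum_four_of_haarGraph (T := {0, 1, 2, 3, 4, 5, 6}) (by decide) (by simp) (by simp)
    (by simp) ?_
  simp; omega

theorem mem_kgSpectrum_six_four {n : ℕ} (h : 12 ≤ n) (h13 : n ≠ 13) : n ∈ kgSpectrum 6 4 := by
  by_cases h15 : n = 15
  · subst h15
    -- The odd set used below fails here because `5 + 5 + 5 = 15`.
    exact mem_kgSpectrum_four (T := {-6, -4, -1, 1, 4, 6}) (by decide) (a := -6) (u := 4) (by decide)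
      (by decide) (by decide) (by decide) (by decide) (by decide) (by decide) (by decide)
      (by decide)
  · have hT : ∀ t ∈ ({-5, -3, -1, 1, 3, 5} : Finset ℤ), t % 2 = 1 ∧ -5 ≤ t ∧ t ≤ 5 := by decide
    refine mem_kgSpectrum_four (T := {-5, -3, -1, 1, 3, 5}) (by decide) (a := -5) (u := 3) (by omega)
      ?_ ?_ ?_ (by simp) (by simp) (by omega) (by omega) ?_
    · simp; omega
    · simp; omega
    · intro t ht
      exact ⟨-t, by revert t; decide, by simp⟩
    · rintro r hr s hs t ht ⟨k, hk⟩
      have hr := hT r hr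
      have hs := hT s hs
      have ht := hT t ht
      -- A sum of three elements is odd and at most 15 in absolute value, while `n ≥ 12`; a multiple
      -- of `n` of this kind could only be `±13` or `±15`, both excluded.
      have hk1 : -2 < k := by nlinarith
      have hk2 : k < 2 := by nlinarith
      have : k = -1 ∨ k = 0 ∨ k = 1 := by omega
      rcases this with rfl | rfl | rfl <;> omega

theorem mem_kgSpectrum_five_six {n : ℕ} (hn : Even n) (h : 42 ≤ n) (h44 : n ≠ 44) :
    n ∈ kgSpectrum 5 6 := by
  obtain ⟨m, rfl⟩ := hn
  by_cases h21 : m = 21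
  · subst h21
    -- A perfect difference set modulo 21: the graph is the incidence graph of the projective plane
    -- of order 4.
    exact mem_kgSpectrum_six_of_haarGraph (m := 21) (T := {0, 1, 4, 14, 16}) (by decide) (by decide)
      (by decide)
      (by decide) (by decide) (by decide) (by decide)
  -- A Golomb ruler of length 11. Since `m ≥ 23` exceeds twice its length, congruences `a + c ≡ b +
  -- d` are equalities of integers.
  · refine mem_kgSpectrum_six_of_haarGraph (T := {0, 1, 4, 9, 11}) (by decide) (by omega) (by simp)
      (by simp) (by simp) (by simp; omega) fun a ha b hb c hc d hd hdvd => ?_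
    have hT : ∀ t ∈ ({0, 1, 4, 9, 11} : Finset ℤ), 0 ≤ t ∧ t ≤ 11 := by decide
    have ha' := hT a ha
    have hb' := hT b hb
    have hc' := hT c hc
    have hd' := hT d hd
    have h0 := Int.eq_zero_of_abs_lt_dvd hdvd (by rw [abs_lt]; omega)
    have key : ∀ a ∈ ({0, 1, 4, 9, 11} : Finset ℤ), ∀ b ∈ ({0, 1, 4, 9, 11} : Finset ℤ),
        ∀ c ∈ ({0, 1, 4, 9, 11} : Finset ℤ), ∀ d ∈ ({0, 1, 4, 9, 11} : Finset ℤ),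
        a + c - (b + d) = 0 → a = b ∨ a = d := by decide
    exact key a ha b hb c hc d hd h0

/-! ### The determinant obstruction -/

namespace Equiv.Perm

/-- Both involutions have cycle type `2^m`, hence are conjugate. -/
theorem exists_equiv_sum_of_involutive {ι : Type*} [Fintype ι] {m : ℕ}
    (hι : Fintype.card ι = m + m) (σ : Equiv.Perm ι) (h2 : ∀ i, σ (σ i) = i) (hf : ∀ i, σ i ≠ i) :
    ∃ e : ι ≃ Fin m ⊕ Fin m, ∀ i, e (σ i) = (e i).swap := by
  classical
  have key : ∀ τ : Equiv.Perm ι, (∀ i, τ (τ i) = i) → (∀ i, τ i ≠ i) →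
      τ.cycleType = Multiset.replicate m 2 := by
    intro τ h2 hf
    have : Fact (Nat.Prime 2) := ⟨Nat.prime_two⟩
    have h := cycleType_of_pow_prime_eq_one (σ := τ) (p := 2) (by ext i; simp [pow_two, h2])
    have hs := τ.sum_cycleType
    have hsupp : τ.support = Finset.univ := by ext i; simp [hf]
    rw [hsupp, Finset.card_univ, hι, h, Multiset.sum_replicate, smul_eq_mul] at hs
    rw [h]
    congr 1
    omega
  let e₀ : ι ≃ Fin m ⊕ Fin m := Fintype.equivOfCardEq (by simp [hι])
  let τ : Equiv.Perm ι := (e₀.trans (Equiv.sumComm _ _)).trans e₀.symm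
  have hτ2 : ∀ i, τ (τ i) = i := fun i => by simp [τ]
  have hτf : ∀ i, τ i ≠ i := fun i h => by
    have : (e₀ i).swap = e₀ i := by
      rw [← e₀.apply_eq_iff_eq] at h
      simpa [τ] using h
    revert this
    cases e₀ i <;> simp
  obtain ⟨c, hc⟩ := isConj_iff.1 (isConj_iff_cycleType_eq.2 ((key σ h2 hf).trans
    (key τ hτ2 hτf).symm))
  refine ⟨c.trans e₀, fun i => ?_⟩
  have : τ (c i) = c (σ i) := by rw [← hc]; simp
  simp [← this, τ]

end Equiv.Perm

namespace Matrix

theorem det_fromBlocks_comm {n R : Type*} [Fintype n] [DecidableEq n] [CommRing R]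
    (A B : Matrix n n R) : (fromBlocks A B B A).det = (A + B).det * (A - B).det := by
  have h : fromBlocks 1 1 0 1 * fromBlocks A B B A * fromBlocks 1 (-1) 0 1 =
      fromBlocks (A + B) 0 B (A - B) := by
    simp only [fromBlocks_multiply]
    congr 1 <;> simp <;> abel
  have := congrArg det h
  simpa [det_mul, det_fromBlocks_zero₂₁, det_fromBlocks_zero₁₂] using this

theorem det_smul_one_add_const {n : Type*} [Fintype n] [DecidableEq n] {a b : ℚ} (ha : a ≠ 0) :
    (a • (1 : Matrix n n ℚ) + of fun _ _ => b).det =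
      a ^ Fintype.card n * (1 + Fintype.card n * (b / a)) := by
  have : a • (1 : Matrix n n ℚ) + of (fun _ _ => b) =
      a • ((1 : Matrix n n ℚ) +
        replicateCol Unit (fun _ : n => (1 : ℚ)) * replicateRow Unit (fun _ : n => b / a)) := by
    ext i j
    simp [mul_apply, mul_add, mul_div_cancel₀, ha]
  rw [this, det_smul, det_one_add_replicateCol_mul_replicateRow]
  simp [dotProduct]

/-- In a basis adapted to `σ` the blocks are `A = 4I + J` and `B = J - I` of order 11; `det (A + B)
= det (3I + 2J) = 3^10 * 25` and `det (A - B) = 5^11`. -/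
theorem det_of_involutive {ι : Type*} [Fintype ι] [DecidableEq ι] (hι : Fintype.card ι = 22)
    (σ : Equiv.Perm ι) (h2 : ∀ i, σ (σ i) = i) (hf : ∀ i, σ i ≠ i) :
    (of fun i j : ι => (if i = j then (4 : ℚ) else 0) + 1 - if σ i = j then 1 else 0).det =
      5 * (5 ^ 6 * 3 ^ 5) ^ 2 := by
  obtain ⟨e, he⟩ := σ.exists_equiv_sum_of_involutive (m := 11) hι h2 hf
  rw [← det_submatrix_equiv_self e.symm]
  have he' : ∀ x, σ (e.symm x) = e.symm x.swap := fun x => by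
    rw [← e.apply_eq_iff_eq, he]; simp
  have : (of fun i j : ι => (if i = j then (4 : ℚ) else 0) + 1 - if σ i = j then 1 else 0).submatrix
      e.symm e.symm = fromBlocks ((4 : ℚ) • (1 : Matrix (Fin 11) (Fin 11) ℚ) + of fun _ _ => 1)
        ((-1 : ℚ) • 1 + of fun _ _ => 1) ((-1 : ℚ) • 1 + of fun _ _ => 1)
        ((4 : ℚ) • 1 + of fun _ _ => 1) := by
    ext (i | i) (j | j) <;> simp [he', one_apply] <;> ring
  rw [this, det_fromBlocks_comm]
  have h1 : (4 : ℚ) • (1 : Matrix (Fin 11) (Fin 11) ℚ) + of (fun _ _ => 1) +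
      ((-1 : ℚ) • 1 + of fun _ _ => 1) = (3 : ℚ) • 1 + of fun _ _ => 2 := by
    ext i j
    simp [one_apply]
    split_ifs <;> norm_num
  have h3 : (4 : ℚ) • (1 : Matrix (Fin 11) (Fin 11) ℚ) + of (fun _ _ => 1) -
      ((-1 : ℚ) • 1 + of fun _ _ => 1) = (5 : ℚ) • 1 := by
    ext i j
    simp [one_apply]
    split_ifs <;> norm_num
  rw [h1, h3, det_smul_one_add_const (by norm_num), det_smul, det_one]
  norm_num

/-- No square matrix of order `22` has Gram matrix `4I + J - P` with `P` the permutation matrix of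
a fixed-point-free involution. -/
theorem gram_false {ι : Type*} [Fintype ι] [DecidableEq ι] (hι : Fintype.card ι = 22)
    (N : Matrix ι ι ℚ) (hdiag : ∀ i, (N * Nᵀ) i i = 5)
    (hoff : ∀ i j, i ≠ j → (N * Nᵀ) i j = 0 ∨ (N * Nᵀ) i j = 1)
    (hrow : ∀ i, ∑ j, (N * Nᵀ) i j = 25) : False := by
  set M := N * Nᵀ with hM
  have hsymm : ∀ i j, M i j = M j i := fun i j => by
    have : Mᵀ = M := by simp [hM]
    conv_lhs => rw [← this]
    rfl
  -- Off the diagonal, 21 entries in `{0, 1}` sum to `25 - 5 = 20`, so exactly one is zero; by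
  -- symmetry its position defines an involution.
  have hex : ∀ i, ∃ j, (j ≠ i ∧ M i j = 0) ∧ ∀ k, k ≠ i ∧ M i k = 0 → k = j := by
    intro i
    have hs : ∑ j ∈ Finset.univ.erase i, M i j = 20 := by
      have := Finset.add_sum_erase Finset.univ (M i) (Finset.mem_univ i)
      rw [hrow, hdiag] at this
      linarith
    have hs' : ∑ j ∈ Finset.univ.erase i, (1 - M i j) = 1 := by
      rw [Finset.sum_sub_distrib, hs]
      simp [hι]
      norm_num
    have hs'' : ∑ j ∈ Finset.univ.erase i, (if M i j = 0 then (1 : ℚ) else 0) = 1 := by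
      refine Eq.trans (Finset.sum_congr rfl fun j hj => ?_) hs'
      rcases hoff i j (Finset.ne_of_mem_erase hj).symm with h | h <;> simp [h]
    rw [Finset.sum_boole] at hs''
    obtain ⟨j, hj⟩ := Finset.card_eq_one.1 (by exact_mod_cast hs'')
    refine ⟨j, ?_, fun k hk => ?_⟩
    · have : j ∈ ({j} : Finset ι) := by simp
      rw [← hj] at this
      simpa using this
    · rw [← Finset.mem_singleton, ← hj]
      simpa using hk
  choose s hs hs' using hex
  have hinv : ∀ i, s (s i) = i := fun i =>
    (hs' (s i) i ⟨(hs i).1.symm, by rw [hsymm]; exact (hs i).2⟩).symm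
  have hMs : M = of fun i j : ι => (if i = j then (4 : ℚ) else 0) + 1 - if s i = j then 1 else 0 := by
    ext i j
    rw [of_apply]
    by_cases hij : i = j
    · subst hij
      rw [hdiag, if_pos rfl, if_neg (hs i).1]
      norm_num
    · rw [if_neg hij]
      by_cases hsij : s i = j
      · subst hsij
        rw [if_pos rfl, (hs i).2]
        norm_num
      · rw [if_neg hsij]
        have : M i j ≠ 0 := fun h => hsij (hs' i j ⟨Ne.symm hij, h⟩).symm
        rcases hoff i j hij with h | h
        · exact absurd h this
        · rw [h]; norm_num
  have hdet := det_of_involutive hι (Function.Involutive.toPerm s hinv) hinv fun i => (hs i).1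
  have hdet' : N.det * N.det = 5 * (5 ^ 6 * 3 ^ 5) ^ 2 := by
    rw [← hdet]
    conv_lhs => arg 2; rw [← det_transpose]
    rw [← det_mul, ← hM, hMs]
    rfl
  have hsq : IsSquare ((5 : ℕ) : ℚ) := ⟨N.det / (5 ^ 6 * 3 ^ 5), by
    rw [div_mul_div_comm, hdet']; norm_num⟩
  rw [Rat.isSquare_natCast_iff] at hsq
  exact Nat.prime_five.prime.not_isSquare hsq

end Matrix

/-! ### Distance layers in girth at least six -/

namespace SimpleGraph
open Classical in
/-- The vertices reached from `u` by a walk of length two that does not turn back. -/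
noncomputable def sphereTwo {V : Type*} [Fintype V] (G : SimpleGraph V) (u : V) : Finset V :=
  {z | z ≠ u ∧ ∃ v, G.Adj u v ∧ G.Adj v z}

open Classical in
/-- The vertices at distance greater than two from `u`. -/
noncomputable def outer {V : Type*} [Fintype V] (G : SimpleGraph V) (u : V) : Finset V :=
  {z | z ≠ u ∧ ¬ G.Adj u z ∧ z ∉ G.sphereTwo u}

/-- There are no cycles of length at most five, in elementary terms. -/
structure GirthGeSix {V : Type*} (G : SimpleGraph V) : Prop where
  three : ∀ a b c, G.Adj a b → G.Adj b c → G.Adj c a → False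
  four : ∀ a b c d, G.Adj a b → G.Adj b c → G.Adj c d → G.Adj d a → a ≠ c → b = d
  five : ∀ a b c d e, G.Adj a b → G.Adj b c → G.Adj c d → G.Adj d e → G.Adj e a → False

theorem not_adj_of_four_le_egirth {V : Type*} {G : SimpleGraph V} (h : 4 ≤ G.egirth) {a b c : V}
    (hab : G.Adj a b) (hbc : G.Adj b c) (hca : G.Adj c a) : False := by
  have := h.trans (egirth_le_three hab hbc hca)
  exact absurd this (by decide)

theorem girthGeSix_of_six_le_egirth {V : Type*} {G : SimpleGraph V} (h : 6 ≤ G.egirth) :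
    G.GirthGeSix := by
  have h3 : ∀ a b c, G.Adj a b → G.Adj b c → G.Adj c a → False := fun a b c =>
    not_adj_of_four_le_egirth (le_trans (by decide) h)
  refine ⟨h3, fun a b c d hab hbc hcd hda hac => ?_, fun a b c d e hab hbc hcd hde hea => ?_⟩
  · by_contra hbd
    exact absurd (h.trans (egirth_le_four hab hbc hcd hda hac hbd)) (by decide)
  -- A closed 5-walk with a repeated vertex contains a triangle, so `five` needs no distinctness
  -- assumption.
  · have hac : a ≠ c := by rintro rfl; exact h3 _ _ _ hcd hde hea
    have hbd : b ≠ d := by rintro rfl; exact h3 _ _ _ hde hea hab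
    have hce : c ≠ e := by rintro rfl; exact h3 _ _ _ hea hab hbc
    have hda : d ≠ a := by rintro rfl; exact h3 _ _ _ hab hbc hcd
    have heb : e ≠ b := by rintro rfl; exact h3 _ _ _ hbc hcd hde
    refine absurd (h.trans (egirth_le_five hab hbc hcd hde hea ?_)) (by decide)
    simp [hac, hbd, hce, hda.symm, heb.symm, hab.ne, hbc.ne, hcd.ne, hde.ne, hea.ne.symm]

section
variable {V : Type*} [Fintype V] {G : SimpleGraph V} {u v w z : V}

theorem mem_sphereTwo : z ∈ G.sphereTwo u ↔ z ≠ u ∧ ∃ v, G.Adj u v ∧ G.Adj v z := by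
  simp [sphereTwo]

theorem mem_outer : z ∈ G.outer u ↔ z ≠ u ∧ ¬ G.Adj u z ∧ z ∉ G.sphereTwo u := by
  simp [outer]

namespace GirthGeSix
variable (hG : G.GirthGeSix)
include hG

theorem not_adj_of_mem_sphereTwo (hw : w ∈ G.sphereTwo u) (hz : z ∈ G.sphereTwo u) :
    ¬ G.Adj w z := by
  obtain ⟨-, a, ha, haw⟩ := mem_sphereTwo.1 hw
  obtain ⟨-, b, hb, hbz⟩ := mem_sphereTwo.1 hz
  exact fun h => hG.five _ _ _ _ _ ha haw h hbz.symm hb.symm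

theorem notMem_sphereTwo_of_adj (h : G.Adj u z) : z ∉ G.sphereTwo u := fun hz => by
  obtain ⟨-, a, ha, haz⟩ := mem_sphereTwo.1 hz
  exact hG.three _ _ _ ha haz h.symm

theorem mem_outer_iff_of_mem_sphereTwo (huv : G.Adj u v) (hz : z ∈ G.sphereTwo v) :
    z ∈ G.outer u ↔ ¬ G.Adj u z := by
  rw [mem_outer]
  refine ⟨fun h => h.2.1, fun h => ⟨?_, h, fun hzu => ?_⟩⟩
  · rintro rfl
    exact hG.notMem_sphereTwo_of_adj huv.symm hz
  · obtain ⟨-, a, ha, haz⟩ := mem_sphereTwo.1 hz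
    obtain ⟨-, b, hb, hbz⟩ := mem_sphereTwo.1 hzu
    exact hG.five _ _ _ _ _ huv ha haz hbz.symm hb.symm

open Classical in
theorem card_sphereTwo {k : ℕ} (hk : ∀ v, G.degree v = k) (u : V) :
    (G.sphereTwo u).card = k * (k - 1) := by
  have h : G.sphereTwo u = (G.neighborFinset u).biUnion fun v => (G.neighborFinset v).erase u := by
    ext z
    simp only [mem_sphereTwo, Finset.mem_biUnion, mem_neighborFinset, Finset.mem_erase]
    grind
  rw [h, Finset.card_biUnion]
  · rw [Finset.sum_congr rfl (g := fun _ => k - 1), Finset.sum_const, smul_eq_mul,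
      card_neighborFinset_eq_degree, hk]
    intro v hv
    rw [Finset.card_erase_of_mem (by simpa [adj_comm] using hv), card_neighborFinset_eq_degree, hk]
  · intro v hv w hw hvw
    rw [Function.onFun, Finset.disjoint_left]
    intro z hz hz'
    simp only [Finset.mem_coe, mem_neighborFinset, Finset.mem_erase] at hv hw hz hz'
    exact hvw (hG.four _ _ _ _ hv hz.2 hz'.2.symm hw.symm hz.1.symm)

open Classical in
theorem card_outer {k : ℕ} (hk : ∀ v, G.degree v = k) (u : V) :
    (G.outer u).card + (1 + k + k * (k - 1)) = Fintype.card V := by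
  have h : G.outer u = ({u} ∪ G.neighborFinset u ∪ G.sphereTwo u)ᶜ := by
    ext z
    simp [mem_outer]
  have hd1 : Disjoint {u} (G.neighborFinset u) := by simp
  have hd2 : Disjoint ({u} ∪ G.neighborFinset u) (G.sphereTwo u) := by
    rw [Finset.disjoint_left]
    intro z hz
    rcases Finset.mem_union.1 hz with hz | hz
    · rw [Finset.mem_singleton.1 hz, mem_sphereTwo]
      simp
    · exact hG.notMem_sphereTwo_of_adj (by simpa using hz)
  rw [h, ← Finset.card_compl_add_card ({u} ∪ G.neighborFinset u ∪ G.sphereTwo u),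
    Finset.card_union_of_disjoint hd2, Finset.card_union_of_disjoint hd1, hG.card_sphereTwo hk,
    card_neighborFinset_eq_degree, hk, Finset.card_singleton]

-- Of the `k * (k - 1)` vertices two steps from `v`, exactly the `k - 1` other neighbours of `u` are
-- not outer.
open Classical in
theorem card_outer_inter_sphereTwo {k : ℕ} (hk : ∀ v, G.degree v = k) (huv : G.Adj u v) :
    (G.outer u ∩ G.sphereTwo v).card = (k - 1) * (k - 1) := by
  have h : G.outer u ∩ G.sphereTwo v = G.sphereTwo v \ (G.neighborFinset u).erase v := by
    ext z
    simp only [Finset.mem_inter, Finset.mem_sdiff, Finset.mem_erase, mem_neighborFinset]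
    constructor
    · rintro ⟨h1, h2⟩
      exact ⟨h2, fun h => (hG.mem_outer_iff_of_mem_sphereTwo huv h2).1 h1 h.2⟩
    · rintro ⟨h1, h2⟩
      refine ⟨(hG.mem_outer_iff_of_mem_sphereTwo huv h1).2 fun h => h2 ⟨?_, h⟩, h1⟩
      exact (mem_sphereTwo.1 h1).1
  rw [h, Finset.card_sdiff_of_subset, hG.card_sphereTwo hk, Finset.card_erase_of_mem (by simpa),
    card_neighborFinset_eq_degree, hk, ← Nat.sub_one_mul]
  intro z hz
  rw [Finset.mem_erase, mem_neighborFinset] at hz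
  exact mem_sphereTwo.2 ⟨hz.1, u, huv.symm, hz.2⟩

/-- The Moore bound for girth six. -/
theorem moore_bound [Nonempty V] {k : ℕ} (hk : ∀ v, (G.neighborSet v).ncard = k) (h0 : 0 < k) :
    1 + k + k * (k - 1) + (k - 1) * (k - 1) ≤ Fintype.card V := by
  classical
  have hk' : ∀ v, G.degree v = k := fun v => by
    rw [← hk v, ← card_neighborFinset_eq_degree, ← Set.ncard_coe_finset, coe_neighborFinset]
  obtain ⟨u⟩ := ‹Nonempty V›
  obtain ⟨v, hv⟩ := (G.degree_pos_iff_exists_adj u).1 (by rw [hk']; exact h0)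
  have h1 := hG.card_outer hk' u
  have h2 := hG.card_outer_inter_sphereTwo hk' hv
  have h3 := Finset.card_le_card (Finset.inter_subset_left : G.outer u ∩ G.sphereTwo v ⊆ _)
  omega

-- The non-outer neighbours of `z` lie in the second sphere of `u`. Middle edges of paths from `z`
-- to `u` match them bijectively with the neighbours `v` of `u` two steps from `z`; complementing in
-- two sets of size `k` gives the claim.
open Classical in
theorem card_neighborFinset_inter_outer (hz : z ∈ G.outer u) {k : ℕ} (hk : ∀ v, G.degree v = k) :
    (G.neighborFinset z ∩ G.outer u).card =
      ((G.neighborFinset u).filter fun v => z ∉ G.sphereTwo v).card := by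
  obtain ⟨hzu, hnz, hzs⟩ := mem_outer.1 hz
  have key : (G.neighborFinset z \ G.outer u).card =
      ((G.neighborFinset u).filter fun v => z ∈ G.sphereTwo v).card := by
    have := Finset.card_mul_eq_card_mul (s := G.neighborFinset z \ G.outer u)
      (t := (G.neighborFinset u).filter fun v => z ∈ G.sphereTwo v) (m := 1) (n := 1) G.Adj
      (fun w hw => ?_) (fun v hv => ?_)
    · simpa using this
    · rw [Finset.mem_sdiff, mem_neighborFinset] at hw
      have hwu : w ≠ u := by rintro rfl; exact hnz hw.1.symm
      have hws : w ∈ G.sphereTwo u := by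
        by_contra hws
        refine hw.2 (mem_outer.2 ⟨hwu, fun h => hzs ?_, hws⟩)
        exact mem_sphereTwo.2 ⟨hzu, w, h, hw.1.symm⟩
      obtain ⟨-, v, hv, hvw⟩ := mem_sphereTwo.1 hws
      rw [Finset.card_eq_one]
      refine ⟨v, Finset.eq_singleton_iff_unique_mem.2 ⟨?_, fun v' hv' => ?_⟩⟩
      · simp only [Finset.mem_bipartiteAbove, Finset.mem_filter, mem_neighborFinset]
        refine ⟨⟨hv, mem_sphereTwo.2 ⟨?_, w, hvw, hw.1.symm⟩⟩, hvw.symm⟩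
        rintro rfl
        exact hnz hv
      · simp only [Finset.mem_bipartiteAbove, Finset.mem_filter, mem_neighborFinset] at hv'
        exact hG.four _ _ _ _ hv'.1.1 hv'.2.symm hvw.symm hv.symm hwu.symm
    · rw [Finset.mem_filter, mem_neighborFinset] at hv
      obtain ⟨hvz, w, hvw, hwz⟩ := mem_sphereTwo.1 hv.2
      rw [Finset.card_eq_one]
      refine ⟨w, Finset.eq_singleton_iff_unique_mem.2 ⟨?_, fun w' hw' => ?_⟩⟩
      · simp only [Finset.mem_bipartiteBelow, Finset.mem_sdiff, mem_neighborFinset]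
        refine ⟨⟨hwz.symm, fun h => ?_⟩, hvw.symm⟩
        have := mem_outer.1 h
        exact this.2.2 (mem_sphereTwo.2 ⟨this.1, v, hv.1, hvw⟩)
      · simp only [Finset.mem_bipartiteBelow, Finset.mem_sdiff, mem_neighborFinset] at hw'
        exact hG.four _ _ _ _ hw'.2.symm hw'.1.1.symm hwz.symm hvw.symm hvz.symm
  have h1 := Finset.card_sdiff_add_card_inter (G.neighborFinset z) (G.outer u)
  have h2 := Finset.card_filter_add_card_filter_not (s := G.neighborFinset u)
    (fun v => z ∈ G.sphereTwo v)
  rw [card_neighborFinset_eq_degree, hk] at h1 h2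
  omega

end GirthGeSix
end
end SimpleGraph

/-! ### No 5-regular graph of girth six on 44 vertices -/

namespace SimpleGraph
namespace GirthGeSix
variable {V : Type*} [Fintype V] {G : SimpleGraph V} (hG : G.GirthGeSix)
include hG

-- For each neighbour `v` of `u`, the outer vertices not two steps from `v` form a set `X v` of size
-- `18 - 16 = 2`, which covers every edge of the outer graph because second spheres are independent.
-- The outer degrees sum to `5 * 2 = 10`.
open Classical in
theorem exists_star_of_card_eq_44 (hk : ∀ v, G.degree v = 5) (hV : Fintype.card V = 44) (u : V) :
    ∃ z ∈ G.outer u, (∀ y, G.Adj z y → y ∈ G.outer u) ∧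
      ∀ a ∈ G.outer u, ∀ b ∈ G.outer u, G.Adj a b → a = z ∨ b = z := by
  set O := G.outer u with hO
  let X : V → Finset V := fun v => O \ G.sphereTwo v
  let d : V → ℕ := fun z => (G.neighborFinset z ∩ O).card
  have hX : ∀ v, G.Adj u v → (X v).card = 2 := fun v hv => by
    have h1 := hG.card_outer hk u
    have h2 := hG.card_outer_inter_sphereTwo hk hv
    have h3 := Finset.card_sdiff_add_card_inter O (G.sphereTwo v)
    rw [← hO] at h1 h2
    change (O \ G.sphereTwo v).card = 2
    omega
  have hd : ∀ z ∈ O, d z = ((G.neighborFinset u).filter fun v => z ∉ G.sphereTwo v).card :=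
    fun z hz => hG.card_neighborFinset_inter_outer hz hk
  have hsum : ∑ z ∈ O, d z = 10 := by
    have h := Finset.sum_card_bipartiteAbove_eq_sum_card_bipartiteBelow
      (s := O) (t := G.neighborFinset u) fun z v => z ∉ G.sphereTwo v
    rw [Finset.sum_congr rfl hd]
    refine h.trans ?_
    rw [Finset.sum_congr rfl (g := fun _ => 2), Finset.sum_const, card_neighborFinset_eq_degree, hk]
    · rfl
    · intro v hv
      rw [← hX v (by simpa using hv)]
      congr 1
      ext z
      simp [X]
  have hcover : ∀ v, ∀ z ∈ O, z ∉ X v → G.neighborFinset z ∩ O ⊆ X v := by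
    intro v z hz hzX y hy
    rw [Finset.mem_inter, mem_neighborFinset] at hy
    have hzs : z ∈ G.sphereTwo v := by
      by_contra h
      exact hzX (Finset.mem_sdiff.2 ⟨hz, h⟩)
    exact Finset.mem_sdiff.2 ⟨hy.2, fun h => hG.not_adj_of_mem_sphereTwo hzs h hy.1⟩
  -- If all outer degrees were at most 2, the cover `X v` would account for a degree sum of at most
  -- `4 + 4 < 10`.
  obtain ⟨z, hz, hz3⟩ : ∃ z ∈ O, 3 ≤ d z := by
    by_contra! hlt
    obtain ⟨v, hv⟩ := (G.degree_pos_iff_exists_adj u).1 (by rw [hk]; norm_num)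
    have hXO : X v ⊆ O := Finset.sdiff_subset
    have hXs : ∑ z ∈ X v, d z ≤ 4 := by
      have := Finset.sum_le_card_nsmul (X v) d 2 fun z hz => Nat.le_of_lt_succ (hlt z (hXO hz))
      rwa [hX v hv] at this
    have hLs : ∑ z ∈ O \ X v, d z ≤ ∑ x ∈ X v, d x := by
      have h := Finset.sum_card_bipartiteAbove_eq_sum_card_bipartiteBelow
        (s := O \ X v) (t := X v) G.Adj
      calc ∑ z ∈ O \ X v, d z ≤ ∑ z ∈ O \ X v, (Finset.bipartiteAbove G.Adj (X v) z).card := by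
            refine Finset.sum_le_sum fun z hz => Finset.card_le_card fun y hy => ?_
            rw [Finset.mem_sdiff] at hz
            rw [Finset.mem_bipartiteAbove]
            exact ⟨hcover v z hz.1 hz.2 hy, by simpa using (Finset.mem_inter.1 hy).1⟩
        _ = _ := h
        _ ≤ _ := by
            refine Finset.sum_le_sum fun x _ => Finset.card_le_card fun y hy => ?_
            rw [Finset.mem_bipartiteBelow, Finset.mem_sdiff] at hy
            rw [Finset.mem_inter, mem_neighborFinset]
            exact ⟨hy.2.symm, hy.1.1⟩
    have := Finset.sum_sdiff (f := d) hXO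
    omega
  -- Outside `X v`, a vertex has all its outer neighbours in `X v`, so at most two; hence `z` lies
  -- in all five sets `X v`.
  have hz5 : d z = 5 := by
    rw [hd z hz, Finset.filter_true_of_mem, card_neighborFinset_eq_degree, hk]
    intro v hv hzs
    have := Finset.card_le_card (hcover v z hz fun h => (Finset.mem_sdiff.1 h).2 hzs)
    rw [hX v (by simpa using hv)] at this
    change d z ≤ 2 at this
    omega
  have hzO : ∀ y, G.Adj z y → y ∈ O := by
    have h : G.neighborFinset z ∩ O = G.neighborFinset z :=
      Finset.eq_of_subset_of_card_le Finset.inter_subset_left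
        (by rw [card_neighborFinset_eq_degree, hk]; exact hz5.ge)
    intro y hy
    have : y ∈ G.neighborFinset z ∩ O := by rw [h]; simpa using hy
    exact (Finset.mem_inter.1 this).2
  -- The vertex `z` and its neighbours already exhaust the degree sum `5 + 5 = 10`. An edge avoiding
  -- `z` thus joins two neighbours of `z`, a triangle.
  have hstar : ∀ a ∈ O, ∀ b ∈ O, G.Adj a b → a ≠ z → G.Adj z a := by
    intro a ha b hb hab haz
    by_contra hza
    have hpos : 1 ≤ d a := Finset.card_pos.2 ⟨b, by simp [hab, hb]⟩
    have hNs : 5 ≤ ∑ y ∈ G.neighborFinset z, d y := by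
      have := Finset.card_nsmul_le_sum (G.neighborFinset z) d 1 fun y hy => by
        refine Finset.card_pos.2 ⟨z, ?_⟩
        rw [mem_neighborFinset] at hy
        simp [hy.symm, hz]
      rwa [card_neighborFinset_eq_degree, hk] at this
    have hsub : insert a (insert z (G.neighborFinset z)) ⊆ O := by
      intro y hy
      rw [Finset.mem_insert, Finset.mem_insert, mem_neighborFinset] at hy
      rcases hy with rfl | rfl | hy
      exacts [ha, hz, hzO y hy]
    have hle := Finset.sum_le_sum_of_subset (f := d) hsub
    rw [Finset.sum_insert (by simp [haz, hza]), Finset.sum_insert (by simp)] at hle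
    omega
  refine ⟨z, hz, hzO, fun a ha b hb hab => ?_⟩
  by_contra! hne
  exact hG.three _ _ _ (hstar a ha b hb hab hne.1) hab (hstar b hb a ha hab.symm hne.2).symm

-- One side is `u`, the star centre `z` and the 20 vertices of the second sphere; the other is the
-- neighbours of `u` with the outer vertices other than `z`, independent because every outer edge
-- meets `z`.
open Classical in
theorem exists_bipartition_of_card_eq_44 (hk : ∀ v, G.degree v = 5) (hV : Fintype.card V = 44) :
    ∃ A : Finset V, A.card = 22 ∧ ∀ x y, G.Adj x y → (x ∈ A ↔ y ∉ A) := by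
  obtain ⟨u⟩ : Nonempty V := Fintype.card_pos_iff.1 (by omega)
  obtain ⟨z, hz, hzO, hstar⟩ := hG.exists_star_of_card_eq_44 hk hV u
  obtain ⟨hzu, hnz, hzs⟩ := mem_outer.1 hz
  refine ⟨insert u (insert z (G.sphereTwo u)), ?_, ?_⟩
  · rw [Finset.card_insert_of_notMem, Finset.card_insert_of_notMem hzs, hG.card_sphereTwo hk]
    simp [hzu.symm, mem_sphereTwo]
  have hu : ∀ y, G.Adj u y → y ∉ insert u (insert z (G.sphereTwo u)) := by
    intro y hy
    simp only [Finset.mem_insert, not_or]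
    exact ⟨hy.ne.symm, fun h => hnz (h ▸ hy), hG.notMem_sphereTwo_of_adj hy⟩
  have hzn : ∀ y, G.Adj z y → y ∉ insert u (insert z (G.sphereTwo u)) := by
    intro y hy
    simp only [Finset.mem_insert, not_or]
    have := mem_outer.1 (hzO y hy)
    exact ⟨this.1, hy.ne.symm, this.2.2⟩
  have hin : ∀ x y, G.Adj x y → x ∈ insert u (insert z (G.sphereTwo u)) →
      y ∉ insert u (insert z (G.sphereTwo u)) := by
    intro x y hxy hx hy
    rcases Finset.mem_insert.1 hx with rfl | hx'
    · exact hu y hxy hy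
    rcases Finset.mem_insert.1 hx' with rfl | hx'
    · exact hzn y hxy hy
    rcases Finset.mem_insert.1 hy with rfl | hy'
    · exact hu x hxy.symm hx
    rcases Finset.mem_insert.1 hy' with rfl | hy'
    · exact hzn x hxy.symm hx
    exact hG.not_adj_of_mem_sphereTwo hx' hy' hxy
  refine fun x y hxy => ⟨hin x y hxy, fun hy => ?_⟩
  by_contra hx
  have hcl : ∀ w, w ∉ insert u (insert z (G.sphereTwo u)) →
      w ≠ z ∧ w ≠ u ∧ w ∉ G.sphereTwo u ∧ (G.Adj u w ∨ w ∈ G.outer u) := by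
    intro w hw
    simp only [Finset.mem_insert, not_or] at hw
    refine ⟨hw.2.1, hw.1, hw.2.2, ?_⟩
    by_cases h : G.Adj u w
    · exact Or.inl h
    · exact Or.inr (mem_outer.2 ⟨hw.1, h, hw.2.2⟩)
  obtain ⟨hx1, hx2, hx3, hx4⟩ := hcl x hx
  obtain ⟨hy1, hy2, hy3, hy4⟩ := hcl y hy
  rcases hx4 with hx4 | hx4
  · exact hy3 (mem_sphereTwo.2 ⟨hy2, x, hx4, hxy⟩)
  rcases hy4 with hy4 | hy4
  · exact hx3 (mem_sphereTwo.2 ⟨hx2, y, hy4, hxy.symm⟩)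
  rcases hstar x hx4 y hy4 hxy with h | h
  exacts [hx1 h, hy1 h]

theorem card_ne_44 (hk : ∀ v, (G.neighborSet v).ncard = 5) : Fintype.card V ≠ 44 := by
  classical
  intro hV
  have hk' : ∀ v, G.degree v = 5 := fun v => by
    rw [← hk v, ← card_neighborFinset_eq_degree, ← Set.ncard_coe_finset, coe_neighborFinset]
  obtain ⟨A, hA, hbip⟩ := hG.exists_bipartition_of_card_eq_44 hk' hV
  have hB : Aᶜ.card = 22 := by rw [Finset.card_compl, hA, hV]
  have hcA : Fintype.card A = 22 := by simpa using hA
  let e : A ≃ (Aᶜ : Finset V) := Fintype.equivOfCardEq (by simp only [Fintype.card_coe, hA, hB])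
  let N : Matrix A A ℚ := Matrix.of fun i j => if G.Adj i (e j) then 1 else 0
  have hmul : ∀ i j, (N * N.transpose) i j =
      ((G.neighborFinset i ∩ G.neighborFinset j).card : ℚ) := by
    intro i j
    have h1 : (N * N.transpose) i j =
        ∑ x : (Aᶜ : Finset V), if G.Adj i x ∧ G.Adj j x then (1 : ℚ) else 0 := by
      rw [← e.sum_comp]
      simp only [Matrix.mul_apply, Matrix.transpose_apply, N, Matrix.of_apply]
      refine Finset.sum_congr rfl fun x _ => ?_
      split_ifs <;> simp_all
    rw [h1, Finset.sum_coe_sort Aᶜ fun x => if G.Adj i x ∧ G.Adj j x then (1 : ℚ) else 0,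
      Finset.sum_boole]
    congr 2
    ext x
    simp only [Finset.mem_filter, Finset.mem_compl, Finset.mem_inter, mem_neighborFinset,
      and_iff_right_iff_imp]
    exact fun h => (hbip _ _ h.1).1 i.2
  refine Matrix.gram_false hcA N (fun i => ?_) (fun i j hij => ?_) fun i => ?_
  · rw [hmul, Finset.inter_self, card_neighborFinset_eq_degree, hk']
    norm_num
  · rw [hmul]
    have : (G.neighborFinset i ∩ G.neighborFinset j).card ≤ 1 := by
      refine Finset.card_le_one.2 fun a ha b hb => ?_
      rw [Finset.mem_inter, mem_neighborFinset, mem_neighborFinset] at ha hb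
      by_contra hab
      exact hij (Subtype.ext (hG.four a j b i ha.2.symm hb.2 hb.1.symm ha.1 hab).symm)
    interval_cases (G.neighborFinset (i : V) ∩ G.neighborFinset (j : V)).card <;> simp
  -- The row sum counts walks of length two from `i`, namely `5 * 5`.
  · simp only [hmul]
    rw [Finset.sum_coe_sort A fun j => ((G.neighborFinset i ∩ G.neighborFinset j).card : ℚ)]
    have h := Finset.sum_card_bipartiteAbove_eq_sum_card_bipartiteBelow
      (s := G.neighborFinset i) (t := A) G.Adj
    have h1 : ∑ b ∈ A, (Finset.bipartiteBelow G.Adj (G.neighborFinset i) b).card =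
        ∑ j ∈ A, (G.neighborFinset i ∩ G.neighborFinset j).card := by
      refine Finset.sum_congr rfl fun j _ => congrArg _ ?_
      ext x
      simp [adj_comm]
    have h2 : ∑ a ∈ G.neighborFinset i, (Finset.bipartiteAbove G.Adj A a).card = 25 := by
      rw [Finset.sum_congr rfl (g := fun _ => 5), Finset.sum_const, card_neighborFinset_eq_degree,
        hk']
      · rfl
      · intro a ha
        rw [← hk' a, ← card_neighborFinset_eq_degree]
        congr 1
        ext x
        simp only [Finset.mem_bipartiteAbove, mem_neighborFinset, and_iff_right_iff_imp]
        intro hax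
        by_contra hx
        exact (hbip _ _ ((mem_neighborFinset _ _ _).1 ha)).1 i.2 ((hbip _ _ hax).2 hx)
    rw [← Nat.cast_sum, ← h1, ← h, h2]
    norm_num

end GirthGeSix

/-! ### Girth four: the bound `2k` and order 13 -/

section
variable {V : Type*} [Fintype V] {G : SimpleGraph V}

theorem two_mul_le_card_of_four_le_egirth [Nonempty V] (hG : 4 ≤ G.egirth) {k : ℕ} (h0 : 0 < k)
    (hk : ∀ v, (G.neighborSet v).ncard = k) : 2 * k ≤ Fintype.card V := by
  classical
  have hk' : ∀ v, G.degree v = k := fun v => by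
    rw [← hk v, ← card_neighborFinset_eq_degree, ← Set.ncard_coe_finset, coe_neighborFinset]
  obtain ⟨u⟩ := ‹Nonempty V›
  obtain ⟨v, hv⟩ := (G.degree_pos_iff_exists_adj u).1 (by rw [hk']; exact h0)
  have hd : Disjoint (G.neighborFinset u) (G.neighborFinset v) := by
    rw [Finset.disjoint_left]
    intro z hz hz'
    rw [mem_neighborFinset] at hz hz'
    exact not_adj_of_four_le_egirth hG hv hz' hz.symm
  have := Finset.card_le_univ (G.neighborFinset u ∪ G.neighborFinset v)
  rw [Finset.card_union_of_disjoint hd, card_neighborFinset_eq_degree,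
    card_neighborFinset_eq_degree, hk', hk'] at this
  omega

-- Let `S` be the neighbours of `u` and `R` the six remaining vertices: 30 edges join `S` to `R`, so
-- degrees inside `R` sum to 6. An edge `rs` in `R` has disjoint neighbourhoods in `S`, hence `d r +
-- d s ≥ 6`.
open Classical in
theorem card_ne_13 (hG : 4 ≤ G.egirth) (hk : ∀ v, (G.neighborSet v).ncard = 6) :
    Fintype.card V ≠ 13 := by
  intro hV
  have hk' : ∀ v, G.degree v = 6 := fun v => by
    rw [← hk v, ← card_neighborFinset_eq_degree, ← Set.ncard_coe_finset, coe_neighborFinset]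
  obtain ⟨u⟩ : Nonempty V := Fintype.card_pos_iff.1 (by omega)
  set S := G.neighborFinset u with hS
  set R := (insert u S)ᶜ with hR
  have hScard : S.card = 6 := by rw [hS, card_neighborFinset_eq_degree, hk']
  have hRcard : R.card = 6 := by
    rw [hR, Finset.card_compl, Finset.card_insert_of_notMem (by simp [hS]), hScard, hV]
  have hSR : ∑ a ∈ S, (Finset.bipartiteAbove G.Adj R a).card = 30 := by
    rw [Finset.sum_congr rfl (g := fun _ => 5), Finset.sum_const, hScard]
    · rfl
    · intro a ha
      rw [hS, mem_neighborFinset] at ha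
      have h : Finset.bipartiteAbove G.Adj R a = (G.neighborFinset a).erase u := by
        ext x
        simp only [Finset.mem_bipartiteAbove, hR, hS, Finset.mem_compl, Finset.mem_insert,
          mem_neighborFinset, Finset.mem_erase, not_or]
        exact ⟨fun h => ⟨h.1.1, h.2⟩, fun h => ⟨⟨h.1, fun hux =>
          not_adj_of_four_le_egirth hG ha h.2 hux.symm⟩, h.2⟩⟩
      rw [h, Finset.card_erase_of_mem (by simpa [adj_comm] using ha),
        card_neighborFinset_eq_degree, hk']
  let d : V → ℕ := fun z => (G.neighborFinset z ∩ R).card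
  let f : V → ℕ := fun z => (G.neighborFinset z ∩ S).card
  have hdf : ∀ z ∈ R, d z + f z = 6 := by
    intro z hz
    simp only [hR, Finset.mem_compl, Finset.mem_insert, hS, mem_neighborFinset, not_or] at hz
    rw [← hk' z, ← card_neighborFinset_eq_degree, ← Finset.card_union_of_disjoint]
    · congr 1
      ext x
      simp only [hR, hS, Finset.mem_union, Finset.mem_inter, Finset.mem_compl, Finset.mem_insert,
        mem_neighborFinset, not_or]
      constructor
      · tauto
      · intro hx
        have : x ≠ u := by rintro rfl; exact hz.2 hx.symm
        tauto
    · rw [Finset.disjoint_left]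
      intro x hx hx'
      simp only [hR, Finset.mem_inter, Finset.mem_compl, Finset.mem_insert, not_or] at hx hx'
      exact hx.2.2 hx'.2
  have hf : ∑ z ∈ R, f z = 30 := by
    rw [← hSR, Finset.sum_card_bipartiteAbove_eq_sum_card_bipartiteBelow]
    refine Finset.sum_congr rfl fun z _ => congrArg Finset.card (Finset.ext fun x => ?_)
    simp [adj_comm, and_comm]
  have hd : ∑ z ∈ R, d z = 6 := by
    have : ∑ z ∈ R, (d z + f z) = 36 := by
      rw [Finset.sum_congr rfl hdf, Finset.sum_const, hRcard]
      rfl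
    rw [Finset.sum_add_distrib] at this
    omega
  obtain ⟨r, hr, hdr⟩ : ∃ r ∈ R, d r ≠ 0 := by
    by_contra! h
    rw [Finset.sum_eq_zero h] at hd
    omega
  obtain ⟨s, hs⟩ := Finset.card_pos.1 (Nat.pos_of_ne_zero hdr)
  rw [Finset.mem_inter, mem_neighborFinset] at hs
  obtain ⟨hrs, hs⟩ := hs
  have hdisj : ∀ x, G.Adj r x → ¬ G.Adj s x := fun x h1 h2 =>
    not_adj_of_four_le_egirth hG hrs h2 h1.symm
  have hfs : f r + f s ≤ 6 := by
    rw [← hScard, ← Finset.card_union_of_disjoint]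
    · exact Finset.card_le_card (Finset.union_subset Finset.inter_subset_right
        Finset.inter_subset_right)
    · rw [Finset.disjoint_left]
      intro x hx hx'
      simp only [Finset.mem_inter, mem_neighborFinset] at hx hx'
      exact hdisj x hx.1 hx'.1
  have h6 : 6 ≤ d r + d s := by
    have := hdf r hr
    have := hdf s hs
    omega
  -- every vertex of `R` is then adjacent to `r` or `s`, so the inner degrees sum to at least `10`
  have hRall : (G.neighborFinset r ∩ R) ∪ (G.neighborFinset s ∩ R) = R := by
    refine Finset.eq_of_subset_of_card_le (Finset.union_subset Finset.inter_subset_right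
      Finset.inter_subset_right) ?_
    rw [hRcard, Finset.card_union_of_disjoint]
    · exact h6
    · rw [Finset.disjoint_left]
      intro x hx hx'
      simp only [Finset.mem_inter, mem_neighborFinset] at hx hx'
      exact hdisj x hx.1 hx'.1
  have hpos : ∀ x ∈ R, 1 ≤ d x := by
    intro x hx
    have hx' := hx
    rw [← hRall, Finset.mem_union, Finset.mem_inter, Finset.mem_inter, mem_neighborFinset,
      mem_neighborFinset] at hx'
    rcases hx' with h | h
    · exact Finset.card_pos.2 ⟨r, by simp [h.1.symm, hr]⟩
    · exact Finset.card_pos.2 ⟨s, by simp [h.1.symm, hs]⟩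
  have hsr := Finset.add_sum_erase R d hr
  have hss := Finset.add_sum_erase (R.erase r) d (Finset.mem_erase.2 ⟨hrs.ne.symm, hs⟩)
  have hrest := Finset.card_nsmul_le_sum ((R.erase r).erase s) d 1 fun x hx =>
    hpos x (Finset.mem_of_mem_erase (Finset.mem_of_mem_erase hx))
  rw [Finset.card_erase_of_mem (Finset.mem_erase.2 ⟨hrs.ne.symm, hs⟩),
    Finset.card_erase_of_mem hr, hRcard, smul_eq_mul] at hrest
  change _ ≤ ∑ x ∈ (R.erase r).erase s, d x at hrest
  omega

end
end SimpleGraph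

/-! ### Necessary conditions and thresholds -/

section orders
variable {n k g : ℕ}

open Classical in
theorem exists_of_mem_kgOrders (h : n ∈ kgOrders k g) : ∃ G : SimpleGraph (Fin n),
    G.IsRegularOfDegree k ∧ (∀ v, (G.neighborSet v).ncard = k) ∧ G.egirth = g := by
  obtain ⟨G, hreg, hg⟩ := h
  refine ⟨G, hreg, fun v => ?_, hg⟩
  rw [← hreg v, ← SimpleGraph.card_neighborFinset_eq_degree, ← Set.ncard_coe_finset,
    SimpleGraph.coe_neighborFinset]

theorem pos_of_mem_kgOrders (h : n ∈ kgOrders k g) : 0 < n := by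
  obtain ⟨G, -, -, hg⟩ := exists_of_mem_kgOrders h
  rcases Nat.eq_zero_or_pos n with rfl | hn
  · have : G.egirth = ⊤ := by
      rw [SimpleGraph.egirth_eq_top]
      exact fun v => v.elim0
    rw [this] at hg
    exact absurd hg.symm (ENat.natCast_ne_top g)
  · exact hn

theorem lt_of_mem_kgOrders (h : n ∈ kgOrders k g) : k < n := by
  classical
  have hn := pos_of_mem_kgOrders h
  obtain ⟨G, hreg, -, -⟩ := exists_of_mem_kgOrders h
  have := G.degree_lt_card_verts ⟨0, hn⟩
  rw [Fintype.card_fin] at this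
  convert this
  exact (hreg _).symm

theorem even_of_mem_kgOrders (hk : Odd k) (h : n ∈ kgOrders k g) : Even n := by
  classical
  obtain ⟨G, hreg, -, -⟩ := exists_of_mem_kgOrders h
  have hs := G.sum_degrees_eq_twice_card_edges
  rw [Finset.sum_congr rfl (g := fun _ => k) (fun v _ => by convert hreg v), Finset.sum_const,
    Finset.card_univ, Fintype.card_fin, smul_eq_mul] at hs
  have : Even (n * k) := by rw [hs]; exact even_two_mul _
  exact (Nat.even_mul.1 this).resolve_right (Nat.not_even_iff_odd.2 hk)

theorem two_mul_le_of_mem_kgOrders (hk : 0 < k) (hg : 4 ≤ g) (h : n ∈ kgOrders k g) :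
    2 * k ≤ n := by
  have : NeZero n := ⟨(pos_of_mem_kgOrders h).ne'⟩
  obtain ⟨G, -, hreg, hG⟩ := exists_of_mem_kgOrders h
  simpa using G.two_mul_le_card_of_four_le_egirth (by rw [hG]; exact_mod_cast hg) hk hreg

theorem moore_bound_of_mem_kgOrders_six (hk : 0 < k) (h : n ∈ kgOrders k 6) :
    1 + k + k * (k - 1) + (k - 1) * (k - 1) ≤ n := by
  have : NeZero n := ⟨(pos_of_mem_kgOrders h).ne'⟩
  obtain ⟨G, -, hreg, hG⟩ := exists_of_mem_kgOrders h
  simpa using (SimpleGraph.girthGeSix_of_six_le_egirth hG.ge).moore_bound hreg hk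

theorem notMem_kgOrders_five_six : 44 ∉ kgOrders 5 6 := fun h => by
  obtain ⟨G, -, hreg, hG⟩ := exists_of_mem_kgOrders h
  exact (SimpleGraph.girthGeSix_of_six_le_egirth hG.ge).card_ne_44 hreg (Fintype.card_fin _)

theorem notMem_kgOrders_six_four : 13 ∉ kgOrders 6 4 := fun h => by
  obtain ⟨G, -, hreg, hG⟩ := exists_of_mem_kgOrders h
  exact G.card_ne_13 hG.ge hreg (Fintype.card_fin _)

/-- `N` is the threshold if all admissible orders from `N` on belong to the spectrum and the last
admissible order `M` before `N` is not the order of a `(k,g)`-graph. -/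
theorem isKGThreshold_of_notMem {N M : ℕ} (hN : AdmissibleOrder k N)
    (hspec : ∀ n, N ≤ n → AdmissibleOrder k n → n ∈ kgSpectrum k g)
    (hM : AdmissibleOrder k M) (hlast : ∀ n < N, AdmissibleOrder k n → n ≤ M)
    (hnot : M ∉ kgOrders k g) : IsKGThreshold k g N := by
  refine ⟨⟨hN, fun n hn hadm => kgSpectrum_subset_kgOrders k g (hspec n hn hadm)⟩, ?_⟩
  rintro L ⟨hL, hall⟩
  by_contra! hlt
  exact hnot (hall M (hlast L hlt hL) hM)

end orders

theorem mainTheorem6 :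
    (kgSpectrum 5 3 = {n : ℕ | Even n ∧ 6 ≤ n} ∧ IsKGThreshold 5 3 6) ∧
    (kgSpectrum 5 4 = {n : ℕ | Even n ∧ 10 ≤ n} ∧ IsKGThreshold 5 4 10) ∧
    (kgSpectrum 5 6 = {42} ∪ {n : ℕ | Even n ∧ 46 ≤ n} ∧ 44 ∉ kgOrders 5 6 ∧
      IsKGThreshold 5 6 46) ∧
    (kgSpectrum 6 3 = {n : ℕ | 7 ≤ n} ∧ IsKGThreshold 6 3 7) ∧
    (kgSpectrum 6 4 = {12} ∪ {n : ℕ | 14 ≤ n} ∧ 13 ∉ kgOrders 6 4 ∧ IsKGThreshold 6 4 14) ∧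
    (kgSpectrum 7 3 = {n : ℕ | Even n ∧ 8 ≤ n} ∧ IsKGThreshold 7 3 8) ∧
    (kgSpectrum 7 4 = {n : ℕ | Even n ∧ 14 ≤ n} ∧ IsKGThreshold 7 4 14) := by
  have o5 : Odd 5 := by decide
  have o7 : Odd 7 := by decide
  have a6 : ∀ n, AdmissibleOrder 6 n := fun n h => absurd h (by decide)
  -- Covers the four odd-degree rows without a gap; `N` is the last even order below the lower
  -- bound.
  have hodd : ∀ {k g N : ℕ}, Odd k → Even N → (∀ n ∈ kgOrders k g, N + 2 ≤ n) →
      (∀ n, Even n → N + 2 ≤ n → n ∈ kgSpectrum k g) →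
      kgSpectrum k g = {n : ℕ | Even n ∧ N + 2 ≤ n} ∧ IsKGThreshold k g (N + 2) := by
    intro k g N hk hN hlow hex
    have hN2 : Even (N + 2) := hN.add even_two
    refine ⟨Set.ext fun n => ⟨fun h => ?_, fun h => hex n h.1 h.2⟩,
      isKGThreshold_of_notMem (M := N) (fun _ => hN2) (fun n hn h => hex n (h hk) hn) (fun _ => hN)
        (fun n hn h => ?_) fun h => ?_⟩
    · have h := kgSpectrum_subset_kgOrders k g h
      exact ⟨even_of_mem_kgOrders hk h, hlow n h⟩
    · have := h hk
      grind
    · have := hlow N h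
      omega
  refine ⟨hodd o5 (by decide) (fun n h => lt_of_mem_kgOrders h)
      fun n => mem_kgSpectrum_five_three,
    hodd o5 (by decide) (fun n h => two_mul_le_of_mem_kgOrders (by norm_num) le_rfl h)
      fun n => mem_kgSpectrum_five_four, ⟨?_, notMem_kgOrders_five_six, ?_⟩, ⟨?_, ?_⟩,
    ⟨?_, notMem_kgOrders_six_four, ?_⟩,
    hodd o7 (by decide) (fun n h => lt_of_mem_kgOrders h)
      fun n => mem_kgSpectrum_seven_three,
    hodd o7 (by decide) (fun n h => two_mul_le_of_mem_kgOrders (by norm_num) le_rfl h)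
      fun n => mem_kgSpectrum_seven_four⟩
  · ext n
    simp only [Set.mem_union, Set.mem_singleton_iff, Set.mem_ofPred_eq]
    constructor
    · intro h
      have h := kgSpectrum_subset_kgOrders 5 6 h
      have h1 := even_of_mem_kgOrders o5 h
      have h2 := moore_bound_of_mem_kgOrders_six (by norm_num) h
      have h3 : n ≠ 44 := by rintro rfl; exact notMem_kgOrders_five_six h
      grind
    · rintro (rfl | ⟨h1, h2⟩)
      · exact mem_kgSpectrum_five_six (by decide) le_rfl (by decide)
      · exact mem_kgSpectrum_five_six h1 (by omega) (by omega)
  · refine isKGThreshold_of_notMem (M := 44) (fun _ => by decide)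
      (fun n hn h => mem_kgSpectrum_five_six (h o5) (by omega) (by omega)) (fun _ => by decide)
      (fun n hn h => ?_) notMem_kgOrders_five_six
    have := h o5
    grind
  · ext n
    exact ⟨fun h => lt_of_mem_kgOrders (kgSpectrum_subset_kgOrders _ _ h),
      mem_kgSpectrum_six_three⟩
  · exact isKGThreshold_of_notMem (M := 6) (a6 _) (fun n hn _ => mem_kgSpectrum_six_three hn) (a6 _)
      (fun n hn _ => by omega) fun h => absurd (lt_of_mem_kgOrders h) (by norm_num)
  · ext n
    simp only [Set.mem_union, Set.mem_singleton_iff, Set.mem_ofPred_eq]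
    constructor
    · intro h
      have h := kgSpectrum_subset_kgOrders 6 4 h
      have h2 := two_mul_le_of_mem_kgOrders (by norm_num) le_rfl h
      have h3 : n ≠ 13 := by rintro rfl; exact notMem_kgOrders_six_four h
      omega
    · rintro (rfl | h)
      · exact mem_kgSpectrum_six_four le_rfl (by decide)
      · exact mem_kgSpectrum_six_four (by omega) (by omega)
  · exact isKGThreshold_of_notMem (M := 13) (a6 _)
      (fun n hn _ => mem_kgSpectrum_six_four (by omega) (by omega)) (a6 _)
      (fun n hn _ => by omega) notMem_kgOrders_six_four
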